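/- Let $O_n=\{Y\in\mathbb R^{n\times n}: Y^\top Y=YY^\top=I_n\}$, with $T_YO_n=\{YA: A^\top=-A\}$, Riemannian metric $\langle V,W\rangle=\mathrm{Tr}(V^\top W)$ (so $\|V\|_Y=\|V\|_F$), Riemannian distance $d$ (infimum of the lengths of piecewise smooth curves in $O_n$), exponential map $\mathrm{Exp}_Y(YC)=Y\,\mathrm{expm}(C)$, and parallel transport along the geodesic $s\mapsto X\,\mathrm{expm}(sC)$ from $X$ to $Y=X\,\mathrm{expm}(C)$ given by $XA\mapsto Y\,\mathrm{expm}(C/2)^\top A\,\mathrm{expm}(C/2)$. Let $\mathcal B=\{\tfrac1{\sqrt2}(e_ie_j^\top-e_je_i^\top):1\le i<j\le n\}$, let $\mathcal B_1,\dots,\mathcal B_m$ be a partition of $\mathcal B$, and put $M=\max_{k}|\mathcal B_k|$. Tangent subspace descent for a differentiable $f:O_n\to\mathbb R$ starts from some $x^0\in O_n$ and, for $t=1,2,\dots$, sets $Y^0=Y^{t,0}:=x^{t-1}$, $Y^{k}=Y^{t,k}:=\mathrm{Exp}_{Y^{k-1}}\bigl(-\eta_{t,k}P_k^{Y^{k-1}}\nabla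 f(Y^{k-1})\bigr)$ for $k=1,\dots,m$ with stepsizes $\eta_{t,k}>0$, and $x^t:=Y^{t,m}$. A selection rule $\mathcal P$ prescribes, from $Y^0,\dots,Y^{k-1}$ and $k$, the orthogonal projection $P_k^{Y^{k-1}}$ of $T_{Y^{k-1}}O_n$. Given an inner loop, let $P_k=\Gamma_{Y^{k-1}}^{Y^0}P_k^{Y^{k-1}}\Gamma_{Y^0}^{Y^{k-1}}$, where $\Gamma_{Y^{k-1}}^{Y^0}$ is parallel transport along a shortest geodesic $s\mapsto\mathrm{Exp}_{Y^{k-1}}(sV_k)$ from $Y^{k-1}$ to $Y^0$ and $\Gamma_{Y^0}^{Y^{k-1}}$ is its inverse, and let $\|\cdot\|_{Y^0,\mathcal P}=\bigl(\sum_{k=1}^m\|P_k(\cdot)\|_{Y^0}^2\bigr)^{1/2}$. The rule is called $(\gamma,r)$-gap ensuring if for every differentiable $f$, every run of the algorithm, every $t\ge1$ with $\max_{1\le k\le m}d(Y^0,Y^k)\le r$, and every choice of the shortest geodesics, there are orthogonal projections $P_1',\dots,P_m'$ of $T_{Y^0}O_n$ with pairwise orthogonal images that span $T_{Y^0}O_n$,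 such that $\mathrm{rank}\,P_k'=\mathrm{rank}\,P_k$ and $\|P_k'-P_k\|\le\gamma$ (operator norm) for all $k$. Theorem. Let $\mathcal P$ be the rule for which $P_k^{Y^{k-1}}$ is the orthogonal projection of $T_{Y^{k-1}}O_n$ onto $\{Y^{k-1}A:A\in\mathrm{span}(\mathcal B_k)\}$, and let $\beta\in(0,1)$. Then $\mathcal P$ is $\bigl(M\sqrt{1-\beta^2},\,2\log(1+\sqrt{1-\beta})\bigr)$-gap ensuring. Moreover, if $\beta>\sqrt{1-\frac1{mM^2}}$, then for every differentiable $f$, every run of the algorithm with the rule $\mathcal P$, every $t\ge1$ such that $d(Y^0,Y^k)\le 2\log(1+\sqrt{1-\beta})$ for each $k=1,\dots,m$, every choice of the shortest geodesics and every skew-symmetric $A$, $$\|Y^0A\|_{Y^0}\le\frac1{1-\sqrt{m(1-\beta^2)}\,M}\,\|Y^0A\|_{Y^0,\mathcal P}.$$ -/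

import Mathlib

open scoped ENNReal ContDiff Matrix

attribute [local instance] Matrix.frobeniusNormedAddCommGroup Matrix.frobeniusNormedSpace

noncomputable section

namespace OrthTSD

/-- Real `n × n` matrices, carrying the Frobenius norm. -/
abbrev Mat (n : ℕ) : Type := Matrix (Fin n) (Fin n) ℝ

/-- The Euclidean inner product `⟨X, Z⟩ = Tr(Xᵀ Z)` on matrices; its norm is the Frobenius norm. -/
instance instInnerMat (n : ℕ) : InnerProductSpace ℝ (Mat n) where
  inner X Z := (Xᵀ * Z).trace
  norm_sq_eq_re_inner X := by
    have h0 : 0 ≤ ∑ i, ∑ j, X i j ^ 2 :=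
      Finset.sum_nonneg fun i _ => Finset.sum_nonneg fun j _ => sq_nonneg _
    rw [Matrix.frobenius_norm_def, ← Real.sqrt_eq_rpow]
    simp only [Real.norm_eq_abs, Real.rpow_two, sq_abs]
    rw [Real.sq_sqrt h0, Finset.sum_comm]
    simp [Matrix.trace, Matrix.mul_apply, sq]
  conj_inner_symm X Z := by
    simpa using (Matrix.trace_transpose (Zᵀ * X)).symm
  add_left X Y Z := by simp [Matrix.add_mul]
  smul_left X Z r := by simp

/-- The manifold `O_n` of orthogonal matrices. -/
abbrev O (n : ℕ) : Type := Matrix.orthogonalGroup (Fin n) ℝ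

/-- `O_n` as a subset of the space of matrices. -/
abbrev OSet (n : ℕ) : Set (Mat n) := (Matrix.orthogonalGroup (Fin n) ℝ : Set (Mat n))

/-- The space of skew-symmetric matrices. -/
def skew (n : ℕ) : Submodule ℝ (Mat n) where
  carrier := {A | Aᵀ = -A}
  add_mem' {A B} hA hB := by
    simp only [Set.mem_ofPred_eq] at *
    rw [Matrix.transpose_add, hA, hB, neg_add]
  zero_mem' := by simp
  smul_mem' c A hA := by
    simp only [Set.mem_ofPred_eq] at *
    rw [Matrix.transpose_smul, hA, smul_neg]

/-- The tangent space `T_Y O_n = {Y A : A skew-symmetric}`, as a space of matrices. -/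
def tangentSpace {n : ℕ} (Y : O n) : Submodule ℝ (Mat n) :=
  (skew n).map (LinearMap.mulLeft ℝ (Y : Mat n))

/-- The tangent space `T_Y O_n` as a type, with the inner product and the norm inherited from the
space of matrices. -/
def T {n : ℕ} (Y : O n) : Type := ↥(tangentSpace Y)

instance {n : ℕ} (Y : O n) : NormedAddCommGroup (T Y) :=
  Submodule.normedAddCommGroup (tangentSpace Y)

instance {n : ℕ} (Y : O n) : InnerProductSpace ℝ (T Y) :=
  Submodule.innerProductSpace (tangentSpace Y)

instance {n : ℕ} (Y : O n) : FiniteDimensional ℝ (T Y) :=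
  inferInstanceAs (FiniteDimensional ℝ ↥(tangentSpace Y))

instance {n : ℕ} (Y : O n) : CompleteSpace (T Y) := FiniteDimensional.complete ℝ (T Y)

/-- The inclusion of `T_Y O_n` into the space of matrices. -/
def toMat {n : ℕ} {Y : O n} : T Y →ₗ[ℝ] Mat n := (tangentSpace Y).subtype

/-- The tangent vector `Y A`, for a skew-symmetric matrix `A`. -/
def ofSkew {n : ℕ} (Y : O n) (A : skew n) : T Y := ⟨(Y : Mat n) * (A : Mat n), A, A.2, rfl⟩

/-! ### Elementary facts that the definitions need -/

theorem transpose_mul_self {n : ℕ} (Y : O n) : (Y : Mat n)ᵀ * (Y : Mat n) = 1 :=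
  (Matrix.mem_orthogonalGroup_iff' _ _).1 Y.2

theorem mul_transpose_self {n : ℕ} (Y : O n) : (Y : Mat n) * (Y : Mat n)ᵀ = 1 :=
  (Matrix.mem_orthogonalGroup_iff _ _).1 Y.2

theorem toMat_injective {n : ℕ} {Y : O n} : Function.Injective (toMat (Y := Y)) :=
  Subtype.val_injective

theorem toMat_ofSkew {n : ℕ} (Y : O n) (A : skew n) :
    toMat (ofSkew Y A) = (Y : Mat n) * (A : Mat n) := rfl

theorem inner_def {n : ℕ} {Y : O n} (V W : T Y) :
    inner ℝ V W = ((toMat V)ᵀ * toMat W).trace := rfl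

theorem transpose_mul_mem_skew {n : ℕ} {Y : O n} (V : T Y) :
    (Y : Mat n)ᵀ * toMat V ∈ skew n := by
  obtain ⟨_, A, hA, rfl⟩ := V
  change (Y : Mat n)ᵀ * ((Y : Mat n) * A) ∈ skew n
  rwa [← Matrix.mul_assoc, transpose_mul_self, one_mul]

/-- The skew-symmetric matrix `A = Yᵀ V` with `V = Y A`. -/
def skewPart {n : ℕ} {Y : O n} (V : T Y) : skew n :=
  ⟨(Y : Mat n)ᵀ * toMat V, transpose_mul_mem_skew V⟩

theorem ofSkew_skewPart {n : ℕ} {Y : O n} (V : T Y) : ofSkew Y (skewPart V) = V := by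
  apply toMat_injective
  rw [toMat_ofSkew, skewPart, ← Matrix.mul_assoc, mul_transpose_self, one_mul]

theorem skewPart_ofSkew {n : ℕ} (Y : O n) (A : skew n) : skewPart (ofSkew Y A) = A := by
  apply Subtype.ext
  change (Y : Mat n)ᵀ * ((Y : Mat n) * (A : Mat n)) = A
  rw [← Matrix.mul_assoc, transpose_mul_self, one_mul]

theorem inner_ofSkew {n : ℕ} (Y : O n) (A B : skew n) :
    inner ℝ (ofSkew Y A) (ofSkew Y B) = ((A : Mat n)ᵀ * (B : Mat n)).trace := by
  rw [inner_def, toMat_ofSkew, toMat_ofSkew, Matrix.transpose_mul, Matrix.mul_assoc,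
    ← Matrix.mul_assoc (Y : Mat n)ᵀ, transpose_mul_self, one_mul]

theorem conj_mem_skew {n : ℕ} (R : Mat n) {A : Mat n} (hA : A ∈ skew n) :
    Rᵀ * A * R ∈ skew n := by
  change Aᵀ = -A at hA
  change (Rᵀ * A * R)ᵀ = -(Rᵀ * A * R)
  simp [Matrix.transpose_mul, hA, Matrix.mul_assoc]

theorem exp_mem_orthogonal {n : ℕ} {A : Mat n} (hA : A ∈ skew n) :
    NormedSpace.exp A ∈ Matrix.orthogonalGroup (Fin n) ℝ := by
  change Aᵀ = -A at hA
  rw [Matrix.mem_orthogonalGroup_iff']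
  change (NormedSpace.exp A)ᵀ * NormedSpace.exp A = 1
  rw [← Matrix.exp_transpose, hA, ← Matrix.exp_add_of_commute _ _ (Commute.neg_left (Commute.refl A))]
  simp

/-! ### Riemannian structure of `O_n` -/

/-- The exponential map `Exp_Y(Y C) = Y expm(C)`. -/
def expMap {n : ℕ} (Y : O n) (V : T Y) : O n :=
  Y * ⟨NormedSpace.exp (skewPart V : Mat n), exp_mem_orthogonal (skewPart V).2⟩

/-- The set-valued inverse of the exponential map: the shortest `V ∈ T_X O_n` with
`Exp_X(V) = Y`. -/
def invExp {n : ℕ} (X Y : O n) : Set (T X) :=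
  {V | expMap X V = Y ∧ ∀ W : T X, expMap X W = Y → ‖V‖ ≤ ‖W‖}

/-- `A ↦ Rᵀ A R` on skew-symmetric matrices. -/
def conj {n : ℕ} (R : O n) (A : skew n) : skew n :=
  ⟨(R : Mat n)ᵀ * (A : Mat n) * (R : Mat n), conj_mem_skew _ A.2⟩

/-- `expm(C / 2)`, where `V = X C`. -/
def halfExp {n : ℕ} {X : O n} (V : T X) : O n :=
  ⟨NormedSpace.exp ((1 / 2 : ℝ) • (skewPart V : Mat n)),
    exp_mem_orthogonal ((skew n).smul_mem _ (skewPart V).2)⟩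

theorem conj_inv_conj {n : ℕ} (R : O n) (A : skew n) : conj R⁻¹ (conj R A) = A := by
  apply Subtype.ext
  change (R : Mat n)ᵀᵀ * ((R : Mat n)ᵀ * (A : Mat n) * (R : Mat n)) * (R : Mat n)ᵀ = A
  rw [Matrix.transpose_transpose]
  calc (R : Mat n) * ((R : Mat n)ᵀ * (A : Mat n) * (R : Mat n)) * (R : Mat n)ᵀ
      = ((R : Mat n) * (R : Mat n)ᵀ) * (A : Mat n) * ((R : Mat n) * (R : Mat n)ᵀ) := by
        simp only [Matrix.mul_assoc]
    _ = A := by rw [mul_transpose_self, one_mul, mul_one]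

theorem trace_conj {n : ℕ} (R : O n) (A : skew n) :
    ((conj R A : Mat n)ᵀ * (conj R A : Mat n)).trace = ((A : Mat n)ᵀ * (A : Mat n)).trace := by
  change (((R : Mat n)ᵀ * (A : Mat n) * (R : Mat n))ᵀ *
    ((R : Mat n)ᵀ * (A : Mat n) * (R : Mat n))).trace = _
  calc _ = ((R : Mat n)ᵀ * ((A : Mat n)ᵀ * ((R : Mat n) * (R : Mat n)ᵀ) * (A : Mat n) *
        (R : Mat n))).trace := by
        simp only [Matrix.transpose_mul, Matrix.transpose_transpose, Matrix.mul_assoc]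
    _ = ((A : Mat n)ᵀ * (A : Mat n) * ((R : Mat n) * (R : Mat n)ᵀ)).trace := by
        rw [mul_transpose_self, mul_one, Matrix.trace_mul_comm, Matrix.mul_assoc,
          mul_transpose_self]
    _ = _ := by rw [mul_transpose_self, mul_one]

/-- Parallel transport `T_X O_n → T_Y O_n` along the geodesic `s ↦ X expm(s C)`, `0 ≤ s ≤ 1`, where
`V = X C` and `Y = Exp_X(V)`: it sends `X A` to `Y expm(C/2)ᵀ A expm(C/2)`. The formula makes sense
for every `Y : O n`, and is used only for `Y = Exp_X(V)`. -/
def parallelTransport {n : ℕ} (X Y : O n) (V : T X) : T X ≃ₗᵢ[ℝ] T Y where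
  toFun W := ofSkew Y (conj (halfExp V) (skewPart W))
  invFun Z := ofSkew X (conj (halfExp V)⁻¹ (skewPart Z))
  map_add' W Z := by
    apply toMat_injective
    simp [toMat_ofSkew, conj, skewPart, Matrix.mul_add, Matrix.add_mul]
  map_smul' c W := by
    apply toMat_injective
    simp [toMat_ofSkew, conj, skewPart]
  left_inv W := by
    dsimp only
    rw [skewPart_ofSkew, conj_inv_conj, ofSkew_skewPart]
  right_inv Z := by
    have h := conj_inv_conj (halfExp V)⁻¹ (skewPart Z)
    rw [inv_inv] at h
    dsimp only
    rw [skewPart_ofSkew, h, ofSkew_skewPart]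
  norm_map' W := by
    rw [← sq_eq_sq₀ (norm_nonneg _) (norm_nonneg _), ← real_inner_self_eq_norm_sq,
      ← real_inner_self_eq_norm_sq]
    change inner ℝ (ofSkew Y (conj (halfExp V) (skewPart W)))
      (ofSkew Y (conj (halfExp V) (skewPart W))) = inner ℝ W W
    rw [inner_ofSkew, trace_conj, ← inner_ofSkew X, ofSkew_skewPart]

/-- `c`, restricted to `[0, 1]`, is a piecewise smooth curve in `O_n` from `X` to `Y`. -/
structure IsPiecewiseSmoothPath {n : ℕ} (X Y : O n) (c : ℝ → Mat n) : Prop where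
  source : c 0 = X
  target : c 1 = Y
  mem : ∀ s ∈ Set.Icc (0 : ℝ) 1, c s ∈ OSet n
  continuousOn : ContinuousOn c (Set.Icc 0 1)
  pieces : ∃ (N : ℕ) (τ : Fin (N + 1) → ℝ), StrictMono τ ∧ τ 0 = 0 ∧ τ (Fin.last N) = 1 ∧
    ∀ i : Fin N, ContDiffOn ℝ ∞ c (Set.Icc (τ i.castSucc) (τ i.succ))

/-- The length `∫₀¹ ‖c'(s)‖ ds` of a curve (`c'` exists outside the finitely many break points). -/
def pathLength {n : ℕ} (c : ℝ → Mat n) : ℝ≥0∞ :=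
  ∫⁻ s in Set.Icc (0 : ℝ) 1, ‖deriv c s‖ₑ

/-- The Riemannian distance on `O_n`: the infimum of the lengths of the piecewise smooth curves in
`O_n` joining the two points (`∞` if there is none). -/
def riemDist {n : ℕ} (X Y : O n) : ℝ≥0∞ :=
  ⨅ (c : ℝ → Mat n) (_ : IsPiecewiseSmoothPath X Y c), pathLength c

/-- The Riemannian gradient at `Y` of the restriction of `f` to `O_n`: the vector `∇f(Y) ∈ T_Y O_n`
with `⟨∇f(Y), V⟩ = df_Y(V)` for all `V ∈ T_Y O_n`. Only the values of `f` on `O_n` matter: if `f` is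
differentiable within `O_n` at `Y`, its derivative there is unique on `T_Y O_n`. -/
def riemGrad {n : ℕ} (f : Mat n → ℝ) (Y : O n) : T Y :=
  (InnerProductSpace.toDual ℝ (T Y)).symm
    ((fderivWithin ℝ f (OSet n) (Y : Mat n)).comp
      (LinearMap.toContinuousLinearMap (toMat (Y := Y))))

/-! ### Tangent subspace descent on `O_n` -/

/-- A deterministic subspace selection rule with `m` inner steps. At the step `k` (counted from `0`)
it receives the inner iterates `Y⁰, …, Yᵏ` and returns an orthogonal projection of the tangent space
at the last of them. -/
structure SelectionRule (n m : ℕ) where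
  proj : (k : Fin m) → (ys : Fin (k + 1) → O n) →
    (T (ys (Fin.last k)) →L[ℝ] T (ys (Fin.last k)))
  isProj : ∀ (k : Fin m) (ys : Fin (k + 1) → O n), IsStarProjection (proj k ys)

/-- The projection of `T_{Yᵏ} O_n` that the rule selects at the step `k` (counted from `0`) of an
inner loop with iterates `Y⁰, Y¹, …`. -/
def SelectionRule.projAt {n m : ℕ} (P : SelectionRule n m) (y : ℕ → O n) (k : Fin m) :
    T (y k) →L[ℝ] T (y k) :=
  P.proj k (fun j : Fin (k + 1) => y j)

/-- `x` (outer iterates), `y t k` (inner iterates, `t ≥ 1`, `0 ≤ k ≤ m`) and the stepsizes `η` are a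
run of tangent subspace descent with objective `f` and selection rule `P`. -/
structure IsTSDRun {n m : ℕ} (f : Mat n → ℝ) (P : SelectionRule n m)
    (x : ℕ → O n) (y : ℕ → ℕ → O n) (η : ℕ → Fin m → ℝ) : Prop where
  stepsize_pos : ∀ t, 1 ≤ t → ∀ k, 0 < η t k
  start : ∀ t, 1 ≤ t → y t 0 = x (t - 1)
  step : ∀ t, 1 ≤ t → ∀ k : Fin m,
    y t (k + 1) = expMap (y t k) (-(η t k • P.projAt (y t) k (riemGrad f (y t k))))
  update : ∀ t, 1 ≤ t → x t = y t m

/-- The projection `Γ_{Yᵏ}^{Y⁰} ∘ P ∘ Γ_{Y⁰}^{Yᵏ}` of `T_{Y⁰} O_n`, where `P` is the projection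
selected at `Yᵏ` and `Γ_{Yᵏ}^{Y⁰}`, with inverse `Γ_{Y⁰}^{Yᵏ}`, is the parallel transport along the
geodesic from `Yᵏ` to `Y⁰` with initial velocity `V k`. -/
def transportedProj {n m : ℕ} (P : SelectionRule n m) (y : ℕ → O n)
    (V : (k : Fin m) → T (y k)) (k : Fin m) : T (y 0) →L[ℝ] T (y 0) :=
  let Γ : T (y k) ≃ₗᵢ[ℝ] T (y 0) := parallelTransport (y k) (y 0) (V k)
  (Γ.toContinuousLinearEquiv : T (y k) →L[ℝ] T (y 0)) ∘L P.projAt y k ∘L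
    (Γ.symm.toContinuousLinearEquiv : T (y 0) →L[ℝ] T (y k))

/-- The seminorm `‖W‖_{Y⁰,P} = √(∑ₖ ‖Pₖ W‖²)` with `Pₖ` the transported projections. -/
def ruleNorm {n m : ℕ} (P : SelectionRule n m) (y : ℕ → O n)
    (V : (k : Fin m) → T (y k)) (W : T (y 0)) : ℝ :=
  √(∑ k, ‖transportedProj P y V k W‖ ^ 2)

/-- Orthogonal projections whose images are pairwise orthogonal and span the space. -/
structure IsOrthogonalDecomposition {E : Type*} [NormedAddCommGroup E] [InnerProductSpace ℝ E]
    [CompleteSpace E] {m : ℕ} (P' : Fin m → E →L[ℝ] E) : Prop where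
  isProj : ∀ k, IsStarProjection (P' k)
  orthogonal : ∀ i j, i ≠ j → (P' i).range ⟂ (P' j).range
  span : ⨆ k, (P' k).range = ⊤

/-- The rule `P` is `(γ, r)`-gap ensuring, for all differentiable objectives on `O_n`, and with
parallel transports along shortest geodesics. -/
def IsGapEnsuring {n m : ℕ} (P : SelectionRule n m) (γ r : ℝ) : Prop :=
  ∀ f : Mat n → ℝ, DifferentiableOn ℝ f (OSet n) →
  ∀ (x : ℕ → O n) (y : ℕ → ℕ → O n) (η : ℕ → Fin m → ℝ), IsTSDRun f P x y η →
  ∀ t, 1 ≤ t →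
    (∀ k : Fin m, riemDist (y t 0) (y t (k + 1)) ≤ ENNReal.ofReal r) →
    ∀ V : (k : Fin m) → T (y t k), (∀ k : Fin m, V k ∈ invExp (y t k) (y t 0)) →
      ∃ P' : Fin m → T (y t 0) →L[ℝ] T (y t 0),
        IsOrthogonalDecomposition P' ∧
        ∀ k, Module.finrank ℝ (transportedProj P (y t) V k).range =
            Module.finrank ℝ (P' k).range ∧
          ‖P' k - transportedProj P (y t) V k‖ ≤ γ

/-! ### The rule given by a partition of the skew basis -/

/-- The basis `{(e_i e_jᵀ - e_j e_iᵀ) / √2 : i < j}` of the skew-symmetric matrices. -/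
def skewBasis (n : ℕ) : Set (Mat n) :=
  {H | ∃ i j : Fin n, i < j ∧ H = (1 / √2) • (Matrix.single i j (1 : ℝ) - Matrix.single j i 1)}

/-- `B` is a partition of the skew basis into `m` blocks. -/
structure IsSkewPartition {n m : ℕ} (B : Fin m → Finset (Mat n)) : Prop where
  disjoint : ∀ i j, i ≠ j → Disjoint (B i) (B j)
  union : ⋃ k, (B k : Set (Mat n)) = skewBasis n

/-- The largest number of elements of a block. -/
def maxCard {n m : ℕ} (B : Fin m → Finset (Mat n)) : ℕ :=
  Finset.univ.sup fun k => (B k).card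

/-- The subspace `{Y A : A ∈ span S}` of `T_Y O_n`. -/
def blockSubspace {n : ℕ} (Y : O n) (S : Finset (Mat n)) : Submodule ℝ (T Y) :=
  ((Submodule.span ℝ (S : Set (Mat n))).map (LinearMap.mulLeft ℝ (Y : Mat n))).comap toMat

/-- The rule that selects at the step `k` the orthogonal projection of the tangent space at the
current iterate `Y` onto `{Y A : A ∈ span (B k)}`. -/
def blockRule {n m : ℕ} (B : Fin m → Finset (Mat n)) : SelectionRule n m where
  proj k ys := (blockSubspace (ys (Fin.last k)) (B k)).starProjection
  isProj _ _ := isStarProjection_starProjection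

end OrthTSD

end

namespace OrthTSD

attribute [local instance] Matrix.frobeniusNormedRing Matrix.frobeniusNormedAlgebra

/-! ### The chordal distance is at most the Riemannian distance -/

/-! Identify each tangent space with the skew-symmetric matrices by `A ↦ Y A`. Transport from `Yᵏ`
to `Y⁰` then becomes conjugation by the half rotation `R = expm(C/2)`, so the transported projection
has range `Y⁰ Rᵀ span(Bₖ) R`. It is compared with the projection onto `Y⁰ span(Bₖ)`; these subspaces
decompose the tangent space because the blocks partition an orthonormal basis.

If `‖R - 1‖² ≤ 1 - β`, conjugation by `R` turns each basis matrix by an angle with cosine at least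
`β` (`le_inner_conj_skewVec`). The corresponding rank-one projections differ by at most the sine
`√(1 - β²)`, and summing over a block of at most `M` elements gives the gap.

The bound on `R` (`norm_halfExp_sub_one_sq_le`) does not need the distance to equal `‖C‖`. The
Riemannian distance only has to dominate the chord `‖expm(C) - 1‖`. Minimality of `C` keeps its
rotation angles in `[0, π]`, where half-angle formulas bound `‖expm(C/2) - 1‖` by the chord. With
chord at most `2u` and `u = log(1 + √(1 - β))`, the result is at most `u + u²/2 ≤ e^u - 1 = √(1 -
β)`.

The norm inequality follows from the gap by the triangle inequality in the `ℓ²` sum of `m` copies of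
the tangent space. -/

theorem enorm_sub_le_pathLength {n : ℕ} {X Y : O n} {c : ℝ → Mat n}
    (hc : IsPiecewiseSmoothPath X Y c) : ‖(Y : Mat n) - X‖ₑ ≤ pathLength c := by
  obtain ⟨N, τ, hτ, h0, h1, hs⟩ := hc.pieces
  have key : ∀ i : Fin (N + 1),
      ‖c (τ i) - c 0‖ₑ ≤ ∫⁻ s in Set.Ioc (0 : ℝ) (τ i), ‖deriv c s‖ₑ := by
    intro i
    induction i using Fin.induction with
    | zero => simp [h0]
    | succ i ih =>
      have h0i : 0 ≤ τ i.castSucc := h0 ▸ hτ.monotone (Fin.zero_le _)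
      have hlt : τ i.castSucc ≤ τ i.succ := hτ.monotone i.castSucc_lt_succ.le
      -- Half-open intervals make consecutive pieces disjoint, so the integrals add exactly.
      rw [← Set.Ioc_union_Ioc_eq_Ioc h0i hlt, MeasureTheory.lintegral_union measurableSet_Ioc
        (Set.Ioc_disjoint_Ioc_of_le le_rfl), add_comm]
      have hpiece := enorm_sub_le_lintegral_deriv_of_contDiffOn_Icc
        ((hs i).of_le (by exact_mod_cast le_top)) hlt
      rw [MeasureTheory.restrict_Ioc_eq_restrict_Icc]
      calc ‖c (τ i.succ) - c 0‖ₑ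
          = ‖(c (τ i.succ) - c (τ i.castSucc)) + (c (τ i.castSucc) - c 0)‖ₑ := by
            rw [sub_add_sub_cancel]
        _ ≤ _ := (enorm_add_le _ _).trans (add_le_add hpiece ih)
  have h := key (Fin.last N)
  rw [h1, hc.source, hc.target] at h
  exact h.trans (MeasureTheory.lintegral_mono_set Set.Ioc_subset_Icc_self)

theorem norm_sub_le_of_riemDist_le {n : ℕ} {X Y : O n} {r : ℝ} (hr : 0 ≤ r)
    (h : riemDist X Y ≤ ENNReal.ofReal r) : ‖(Y : Mat n) - X‖ ≤ r := by
  have h1 : ‖(Y : Mat n) - X‖ₑ ≤ ENNReal.ofReal r :=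
    (le_iInf₂ fun _ hc => enorm_sub_le_pathLength hc : _ ≤ riemDist X Y).trans h
  rwa [← ofReal_norm, ENNReal.ofReal_le_ofReal_iff hr] at h1

/-! ### The Frobenius norm and traces -/

theorem norm_sq_eq_trace {n : ℕ} (A : Mat n) : ‖A‖ ^ 2 = (Aᵀ * A).trace :=
  (real_inner_self_eq_norm_sq A).symm

theorem norm_orthogonal_mul {n : ℕ} (Y : O n) (A : Mat n) : ‖(Y : Mat n) * A‖ = ‖A‖ := by
  rw [← sq_eq_sq₀ (norm_nonneg _) (norm_nonneg _), norm_sq_eq_trace, norm_sq_eq_trace,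
    Matrix.transpose_mul, Matrix.mul_assoc, ← Matrix.mul_assoc _ _ A, transpose_mul_self, one_mul]

theorem norm_ofSkew {n : ℕ} (Y : O n) (A : skew n) : ‖ofSkew Y A‖ = ‖(A : Mat n)‖ :=
  norm_orthogonal_mul Y A

/-- The trace may be computed in any orthonormal basis; it is later evaluated in an eigenbasis of
`Cᵀ C`. -/
theorem trace_eq_sum_dotProduct {n : ℕ}
    (b : OrthonormalBasis (Fin n) ℝ (EuclideanSpace ℝ (Fin n))) (N : Mat n) :
    N.trace = ∑ i, (b i).ofLp ⬝ᵥ N *ᵥ (b i).ofLp := by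
  have h := LinearMap.trace_eq_sum_inner (Matrix.toEuclideanLin N) b
  have h2 : (Matrix.toEuclideanLin N).trace ℝ (EuclideanSpace ℝ (Fin n)) = N.trace := by
    rw [Matrix.toEuclideanLin_eq_toLin_orthonormal]
    exact Matrix.trace_toLin_eq N _
  rw [← h2, h]
  refine Finset.sum_congr rfl fun i _ => ?_
  rw [EuclideanSpace.inner_eq_star_dotProduct, dotProduct_comm]
  simp [Matrix.toLpLin_apply]

/-! ### The exponential of a skew-symmetric matrix on its invariant planes -/

/-- If `C` rotates the plane of `v, w` with angular velocity `θ`, then `exp (s C)` rotates it by the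
angle `s θ`. -/
theorem exp_smul_mulVec {n : ℕ} {C : Mat n} {v w : Fin n → ℝ} {θ : ℝ}
    (hv : C *ᵥ v = θ • w) (hw : C *ᵥ w = -θ • v) (s : ℝ) :
    NormedSpace.exp (s • C) *ᵥ v = Real.cos (s * θ) • v + Real.sin (s * θ) • w := by
  -- The backward flow `exp (-t C)` applied to the claimed solution `g t` has derivative zero, hence
  -- stays equal to `v`.
  let E : ℝ → Mat n := fun t => NormedSpace.exp (t • (-C))
  let L : (Mat n) →L[ℝ] (Fin n → ℝ) →L[ℝ] (Fin n → ℝ) :=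
    LinearMap.toContinuousLinearMap
      (LinearMap.toContinuousLinearMap.toLinearMap ∘ₗ Matrix.mulVecBilin ℝ ℝ)
  have hL : ∀ M x, L M x = M *ᵥ x := fun M x => rfl
  let g : ℝ → Fin n → ℝ := fun t => Real.cos (t * θ) • v + Real.sin (t * θ) • w
  have hE : ∀ t, HasDerivAt E (E t * (-C)) t := fun t => hasDerivAt_exp_smul_const (-C) t
  have hg : ∀ t, HasDerivAt g (C *ᵥ g t) t := by
    intro t
    have h1 : HasDerivAt (fun t : ℝ => t * θ) θ t := by simpa using (hasDerivAt_id t).mul_const θ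
    have h2 := (h1.cos.smul_const v).add (h1.sin.smul_const w)
    refine h2.congr_deriv ?_
    simp only [g, Matrix.mulVec_add, Matrix.mulVec_smul, hv, hw, smul_smul]
    rw [add_comm]
    congr 2
    all_goals ring
  have hF : ∀ t, HasDerivAt (fun t => L (E t) (g t)) 0 t := by
    intro t
    have h := ((L.hasFDerivAt (x := E t)).comp_hasDerivAt t (hE t)).clm_apply (hg t)
    refine h.congr_deriv ?_
    change (E t * -C) *ᵥ g t + E t *ᵥ (C *ᵥ g t) = 0
    rw [Matrix.mulVec_mulVec, ← Matrix.add_mulVec]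
    simp
  have hconst : L (E s) (g s) = L (E 0) (g 0) :=
    is_const_of_deriv_eq_zero (fun t => (hF t).differentiableAt) (fun t => (hF t).deriv) s 0
  have h0 : L (E 0) (g 0) = v := by simp [hL, E, g]
  rw [h0, hL] at hconst
  have hinv : NormedSpace.exp (s • C) * E s = 1 := by
    have : Commute (s • C) (s • (-C)) := by
      rw [smul_neg]; exact (Commute.refl _).neg_right
    change _ * NormedSpace.exp (s • (-C)) = 1
    rw [← Matrix.exp_add_of_commute _ _ this]
    simp
  conv_lhs => rw [← hconst]
  rw [Matrix.mulVec_mulVec, hinv, Matrix.one_mulVec]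

/-- Split `x = -J²x + (x + J²x)`: `J` rotates the plane of `-J²x, Jx` with unit speed and kills `x +
J²x`, so a full turn fixes both parts. -/
theorem exp_two_pi_smul_of_cube_eq_neg {n : ℕ} {J : Mat n} (hJ : J * J * J = -J) :
    NormedSpace.exp ((2 * Real.pi) • J) = 1 := by
  apply Matrix.ext_of_mulVec_single
  intro i
  set x : Fin n → ℝ := Pi.single i 1
  have h1 := exp_smul_mulVec (C := J) (v := -((J * J) *ᵥ x)) (w := J *ᵥ x) (θ := 1)
    (by rw [Matrix.mulVec_neg, Matrix.mulVec_mulVec, ← Matrix.mul_assoc, hJ]; simp [Matrix.neg_mulVec])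
    (by simp [Matrix.mulVec_mulVec]) (2 * Real.pi)
  have h2 := exp_smul_mulVec (C := J) (v := x + (J * J) *ᵥ x) (w := 0) (θ := 0)
    (by rw [Matrix.mulVec_add, Matrix.mulVec_mulVec, ← Matrix.mul_assoc, hJ]; simp [Matrix.neg_mulVec])
    (by simp) (2 * Real.pi)
  simp only [mul_one, Real.cos_two_pi, Real.sin_two_pi, one_smul, zero_smul, add_zero, mul_zero,
    Real.cos_zero, Real.sin_zero] at h1 h2
  have h3 := congrArg₂ (· + ·) h1 h2
  simp only [← Matrix.mulVec_add] at h3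
  simpa using h3

end OrthTSD

namespace OrthTSD

attribute [local instance] Matrix.frobeniusNormedRing Matrix.frobeniusNormedAlgebra

/-! ### Eigenvalues of the shortest logarithm -/

theorem dotProduct_skew_mulVec {n : ℕ} {C : Mat n} (hC : C ∈ skew n) (x y : Fin n → ℝ) :
    x ⬝ᵥ C *ᵥ y = -(C *ᵥ x ⬝ᵥ y) := by
  have hC' : Cᵀ = -C := hC
  rw [Matrix.dotProduct_mulVec, ← Matrix.mulVec_transpose, hC', Matrix.neg_mulVec, neg_dotProduct]

/-- A logarithm of least norm has no rotation angle above `π`. -/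
theorem angle_le_pi_of_minimal {n : ℕ} {C : Mat n} (hC : C ∈ skew n)
    (hmin : ∀ D ∈ skew n, NormedSpace.exp D = NormedSpace.exp C → ‖C‖ ≤ ‖D‖)
    {v w : Fin n → ℝ} {θ : ℝ} (hθ : 0 < θ) (hv1 : v ⬝ᵥ v = 1)
    (hv : C *ᵥ v = θ • w) (hw : C *ᵥ w = -θ • v) : θ ≤ Real.pi := by
  have hC' : Cᵀ = -C := hC
  have hvw : v ⬝ᵥ w = 0 := by
    have h := dotProduct_skew_mulVec hC v v
    rw [hv, dotProduct_smul, smul_dotProduct, dotProduct_comm w v, smul_eq_mul] at h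
    have : θ * (v ⬝ᵥ w) = 0 := by linarith
    exact (mul_eq_zero.1 this).resolve_left hθ.ne'
  have hww : w ⬝ᵥ w = 1 := by
    have h := dotProduct_skew_mulVec hC w v
    rw [hv, hw, dotProduct_smul, smul_dotProduct, hv1, smul_eq_mul, smul_eq_mul] at h
    have : θ * (w ⬝ᵥ w - 1) = 0 := by linarith
    linarith [(mul_eq_zero.1 this).resolve_left hθ.ne']
  have hwv : w ⬝ᵥ v = 0 := by rw [dotProduct_comm, hvw]
  -- `J` is the unit-speed rotation of the plane of `v, w`, on which `C` acts as `θ J`. Subtracting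
  -- a full turn `2π J` leaves the exponential unchanged.
  set J : Mat n := Matrix.vecMulVec w v - Matrix.vecMulVec v w with hJ
  have hJT : Jᵀ = -J := by simp [hJ, Matrix.transpose_vecMulVec]
  have hJJ : J * J = -(Matrix.vecMulVec v v + Matrix.vecMulVec w w) := by
    simp only [hJ, Matrix.sub_mul, Matrix.mul_sub, Matrix.vecMulVec_mul_vecMulVec, hv1, hvw, hwv,
      hww, zero_smul, one_smul, Matrix.vecMulVec_zero]
    abel
  have hJ3 : J * J * J = -J := by
    rw [hJJ]
    simp only [hJ, Matrix.neg_mul, Matrix.add_mul, Matrix.mul_sub, Matrix.vecMulVec_mul_vecMulVec,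
      hv1, hvw, hwv, hww, zero_smul, one_smul, Matrix.vecMulVec_zero]
    abel
  have hCJ : C * J = θ • (J * J) := by
    rw [hJJ]
    simp only [hJ, Matrix.mul_sub, Matrix.mul_vecMulVec, hv, hw, Matrix.smul_vecMulVec]
    module
  have hJC : J * C = θ • (J * J) := by
    have h := congrArg Matrix.transpose hCJ
    simpa [Matrix.transpose_mul, hC', hJT] using h
  have hcomm : Commute C ((2 * Real.pi) • -J) := by
    refine Commute.smul_right (Commute.neg_right ?_) _
    exact hCJ.trans hJC.symm
  have hexp : NormedSpace.exp (C + (2 * Real.pi) • -J) = NormedSpace.exp C := by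
    rw [Matrix.exp_add_of_commute _ _ hcomm, exp_two_pi_smul_of_cube_eq_neg, mul_one]
    simp [hJ3]
  have hD : C + (2 * Real.pi) • -J ∈ skew n :=
    (skew n).add_mem hC ((skew n).smul_mem _ ((skew n).neg_mem hJT))
  have hle := pow_le_pow_left₀ (norm_nonneg _) (hmin _ hD hexp) 2
  have htr : (J * J).trace = -2 := by
    rw [hJJ]
    simp only [Matrix.trace_neg, Matrix.trace_add, Matrix.trace_vecMulVec, hv1, hww]
    norm_num
  rw [norm_sq_eq_trace, norm_sq_eq_trace, show (C + (2 * Real.pi) • -J)ᵀ = _ from hD, hC'] at hle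
  simp only [Matrix.neg_mul, Matrix.add_mul, Matrix.mul_add, Matrix.smul_mul, Matrix.mul_smul,
    Matrix.mul_neg, Matrix.trace_neg, Matrix.trace_add, Matrix.trace_smul, hCJ, hJC, htr,
    smul_eq_mul] at hle
  -- The squared norm changes by `-2⟨C, 2πJ⟩ + ‖2πJ‖² = -8πθ + 8π²`, which minimality forces to be
  -- nonnegative.
  have : 0 ≤ 8 * Real.pi * (Real.pi - θ) := by linarith
  have := nonneg_of_mul_nonneg_right this (by positivity)
  linarith

/-- The rotation angles of a skew-symmetric matrix `C`, with multiplicity, are between `0` and `π`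
if `C` is a logarithm of least norm, and determine the distances of `exp (s C)` from `1`. -/
theorem exists_angles {n : ℕ} {C : Mat n} (hC : C ∈ skew n)
    (hmin : ∀ D ∈ skew n, NormedSpace.exp D = NormedSpace.exp C → ‖C‖ ≤ ‖D‖) :
    ∃ θ : Fin n → ℝ, (∀ i, 0 ≤ θ i ∧ θ i ≤ Real.pi) ∧
      ∀ s : ℝ, ‖NormedSpace.exp (s • C) - 1‖ ^ 2 = ∑ i, (2 - 2 * Real.cos (s * θ i)) := by
  have hC' : Cᵀ = -C := hC
  have hpsd : (Cᵀ * C).PosSemidef := by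
    have h := Matrix.posSemidef_conjTranspose_mul_self C
    rwa [Matrix.conjTranspose_eq_transpose_of_trivial] at h
  -- The angles are the singular values of `C`: on an eigenvector of `Cᵀ C = -C²` with eigenvalue
  -- `θ²`, `C` acts as a rotation in the plane of `v` and `θ⁻¹ C v`.
  set b := hpsd.isHermitian.eigenvectorBasis
  set θ : Fin n → ℝ := fun i => √(hpsd.isHermitian.eigenvalues i) with hθ
  set v : Fin n → Fin n → ℝ := fun i => (b i).ofLp with hvdef
  have hθ0 : ∀ i, 0 ≤ θ i := fun i => Real.sqrt_nonneg _
  have hvv : ∀ i, v i ⬝ᵥ v i = 1 := fun i => by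
    have h := b.orthonormal.1 i
    rw [← sq_eq_sq₀ (norm_nonneg _) zero_le_one, ← real_inner_self_eq_norm_sq,
      EuclideanSpace.inner_eq_star_dotProduct] at h
    simpa using h
  have hCC : ∀ i, C *ᵥ (C *ᵥ v i) = -(θ i ^ 2) • v i := fun i => by
    have h := hpsd.isHermitian.mulVec_eigenvectorBasis i
    rw [← Matrix.mulVec_mulVec] at h
    rw [hθ, Real.sq_sqrt (hpsd.eigenvalues_nonneg i), neg_smul, ← neg_eq_iff_eq_neg,
      ← Matrix.neg_mulVec, ← hC']
    exact h
  have hplane : ∀ i, ∃ w, C *ᵥ v i = θ i • w ∧ C *ᵥ w = -θ i • v i := by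
    intro i
    rcases eq_or_ne (θ i) 0 with h0 | h0
    -- For angle zero `C v` vanishes, so `w = 0` serves as a degenerate partner.
    · refine ⟨0, ?_, by simp [h0]⟩
      have h := dotProduct_skew_mulVec hC (v i) (C *ᵥ v i)
      rw [hCC, h0] at h
      have : C *ᵥ v i ⬝ᵥ C *ᵥ v i = 0 := by simpa using h
      simpa using dotProduct_self_eq_zero.1 this
    · refine ⟨(θ i)⁻¹ • C *ᵥ v i, by rw [smul_smul, mul_inv_cancel₀ h0, one_smul], ?_⟩
      rw [Matrix.mulVec_smul, hCC, smul_smul]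
      congr 1
      field_simp
  choose w hv hw using hplane
  refine ⟨θ, fun i => ⟨hθ0 i, ?_⟩, fun s => ?_⟩
  · rcases (hθ0 i).eq_or_lt with h | h
    · rw [← h]; exact Real.pi_pos.le
    · exact angle_le_pi_of_minimal hC hmin h (hvv i) (hv i) (hw i)
  · set R := NormedSpace.exp (s • C) with hR
    have hRT : Rᵀ = NormedSpace.exp ((-s) • C) := by
      rw [hR, ← Matrix.exp_transpose, Matrix.transpose_smul, hC', smul_neg, neg_smul]
    have hRR : Rᵀ * R = 1 :=
      transpose_mul_self ⟨R, exp_mem_orthogonal ((skew n).smul_mem s hC)⟩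
    rw [norm_sq_eq_trace, Matrix.transpose_sub, Matrix.transpose_one,
      show (Rᵀ - 1) * (R - 1) = 2 - (R + Rᵀ) by
        rw [sub_mul, mul_sub, hRR, ← one_add_one_eq_two]; simp; abel,
      trace_eq_sum_dotProduct b]
    refine Finset.sum_congr rfl fun i _ => ?_
    change v i ⬝ᵥ (2 - (R + Rᵀ)) *ᵥ v i = _
    rw [Matrix.sub_mulVec, Matrix.add_mulVec, hRT, hR, exp_smul_mulVec (hv i) (hw i),
      exp_smul_mulVec (hv i) (hw i), neg_mul, Real.cos_neg, Real.sin_neg,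
      ← one_add_one_eq_two (R := Mat n), Matrix.add_mulVec, Matrix.one_mulVec]
    -- The sine terms of `R` and `Rᵀ` cancel, so nothing has to be known about the partner vectors
    -- `w i`.
    rw [show v i + v i - (Real.cos (s * θ i) • v i + Real.sin (s * θ i) • w i +
      (Real.cos (s * θ i) • v i + -Real.sin (s * θ i) • w i)) =
      (2 - 2 * Real.cos (s * θ i)) • v i by module, dotProduct_smul, hvv, smul_eq_mul, mul_one]

/-- Half of a shortest logarithm is closer to the identity than the length of a chord suggests. -/
theorem norm_exp_half_sub_one_le {n : ℕ} {C : Mat n} (hC : C ∈ skew n)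
    (hmin : ∀ D ∈ skew n, NormedSpace.exp D = NormedSpace.exp C → ‖C‖ ≤ ‖D‖)
    {u : ℝ} (hu0 : 0 ≤ u) (hu : u ≤ 7 / 10) (hchord : ‖NormedSpace.exp C - 1‖ ≤ 2 * u) :
    ‖NormedSpace.exp ((1 / 2 : ℝ) • C) - 1‖ ≤ u + u ^ 2 / 2 := by
  obtain ⟨θ, hθ, hs⟩ := exists_angles hC hmin
  have h1 := hs 1
  have h2 := hs (1 / 2)
  rw [one_smul] at h1
  set c : Fin n → ℝ := fun i => Real.cos (1 / 2 * θ i) with hc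
  -- This is where the bound `θ i ≤ π`, and so minimality, enters.
  have hc0 : ∀ i, 0 ≤ c i := fun i => Real.cos_nonneg_of_neg_pi_div_two_le_of_le
    (by linarith [hθ i, Real.pi_pos]) (by linarith [hθ i])
  have hc1 : ∀ i, c i ≤ 1 := fun i => Real.cos_le_one _
  have hdouble : ∀ i, 2 - 2 * Real.cos (1 * θ i) = 4 - 4 * c i ^ 2 := fun i => by
    rw [show 1 * θ i = 2 * (1 / 2 * θ i) by ring, Real.cos_two_mul, hc]; ring
  simp only [hdouble] at h1
  have hterm0 : ∀ i, 0 ≤ 4 - 4 * c i ^ 2 := fun i => by nlinarith [hc0 i, hc1 i]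
  have hchord2 : ‖NormedSpace.exp C - 1‖ ^ 2 ≤ (2 * u) ^ 2 :=
    pow_le_pow_left₀ (norm_nonneg _) hchord 2
  have hterm : ∀ i, 4 - 4 * c i ^ 2 ≤ 4 * u ^ 2 := fun i => by
    have := Finset.single_le_sum (fun j _ => hterm0 j) (Finset.mem_univ i)
    linarith
  have husq : u ^ 2 ≤ 1 / 2 := by nlinarith
  have hpos : 0 < 2 * (2 - u ^ 2) := by linarith
  -- Since `c ≥ c² ≥ 1 - u²`, the factorization `4 - 4c² = (2 - 2c) · 2(1 + c)` has second factor at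
  -- least `2(2 - u²)`.
  have hfac : ∀ i, (2 - 2 * c i) * (2 * (2 - u ^ 2)) ≤ 4 - 4 * c i ^ 2 := fun i => by
    have hcl : 1 - u ^ 2 ≤ c i := by nlinarith [hc0 i, hc1 i, hterm i]
    nlinarith [hc1 i]
  have hsum : ‖NormedSpace.exp ((1 / 2 : ℝ) • C) - 1‖ ^ 2 * (2 * (2 - u ^ 2)) ≤ 4 * u ^ 2 := by
    rw [h2, Finset.sum_mul]
    refine (Finset.sum_le_sum fun i _ => hfac i).trans ?_
    rw [← h1]; linarith
  have hpoly : 4 * u ^ 2 ≤ (u + u ^ 2 / 2) ^ 2 * (2 * (2 - u ^ 2)) := by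
    -- This product is exactly the difference of the two sides of `hpoly`.
    have : 0 ≤ u ^ 3 * (4 - u - 2 * u ^ 2 - u ^ 3 / 2) :=
      mul_nonneg (by positivity) (by nlinarith [pow_nonneg hu0 3])
    nlinarith
  refine (sq_le_sq₀ (norm_nonneg _) (by positivity)).1 ?_
  exact le_of_mul_le_mul_right (hsum.trans hpoly) hpos

end OrthTSD

/-! ### Perturbation of orthogonal projections -/

section Projections

variable {E : Type*} [NormedAddCommGroup E] [InnerProductSpace ℝ E]

theorem norm_inner_smul_sub_inner_smul_le {u v : E} (hu : ‖u‖ = 1) (hv : ‖v‖ = 1) {β : ℝ}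
    (hβ : 0 ≤ β) (huv : β ≤ inner ℝ u v) (x : E) :
    ‖(inner ℝ u x : ℝ) • u - (inner ℝ v x : ℝ) • v‖ ≤ √(1 - β ^ 2) * ‖x‖ := by
  set a : ℝ := inner ℝ u x with ha
  set b : ℝ := inner ℝ v x with hb
  set c : ℝ := inner ℝ u v with hc
  have huu : inner ℝ u u = (1 : ℝ) := by rw [real_inner_self_eq_norm_sq, hu, one_pow]
  have hvv : inner ℝ v v = (1 : ℝ) := by rw [real_inner_self_eq_norm_sq, hv, one_pow]
  have hvu : inner ℝ v u = c := real_inner_comm _ _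
  have hxu : inner ℝ x u = a := real_inner_comm _ _
  have hxv : inner ℝ x v = b := real_inner_comm _ _
  -- Cauchy–Schwarz for the components orthogonal to `u` gives `(b - ca)² ≤ (1 - c²)(‖x‖² - a²)`,
  -- which rearranges to `a² + b² - 2abc ≤ (1 - c²)‖x‖²`.
  have hcs := real_inner_mul_inner_self_le (v - c • u) (x - a • u)
  have h1 : inner ℝ (v - c • u) (x - a • u) = b - c * a := by
    simp only [inner_sub_left, inner_sub_right, real_inner_smul_left, real_inner_smul_right, huu,
      hvu, ← ha, ← hb]
    ring
  have h2 : inner ℝ (v - c • u) (v - c • u) = 1 - c ^ 2 := by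
    simp only [inner_sub_left, inner_sub_right, real_inner_smul_left, real_inner_smul_right, huu,
      hvu, hvv, ← hc]
    ring
  have h3 : inner ℝ (x - a • u) (x - a • u) = ‖x‖ ^ 2 - a ^ 2 := by
    simp only [inner_sub_left, inner_sub_right, real_inner_smul_left, real_inner_smul_right, huu,
      hxu, ← ha, real_inner_self_eq_norm_sq x]
    ring
  rw [h1, h2, h3] at hcs
  have h4 : ‖a • u - b • v‖ ^ 2 = a ^ 2 + b ^ 2 - 2 * a * b * c := by
    rw [← real_inner_self_eq_norm_sq]
    simp only [inner_sub_left, inner_sub_right, real_inner_smul_left, real_inner_smul_right, huu,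
      hvu, hvv, ← hc]
    ring
  have hc1 : c ^ 2 ≤ 1 := by
    have := real_inner_self_nonneg (x := v - c • u)
    linarith
  have hβc : β ^ 2 ≤ c ^ 2 := pow_le_pow_left₀ hβ huv 2
  refine (sq_le_sq₀ (norm_nonneg _) (by positivity)).1 ?_
  rw [h4, mul_pow, Real.sq_sqrt (by linarith)]
  nlinarith [mul_nonneg (sub_nonneg.2 hβc) (sq_nonneg ‖x‖)]

theorem Orthonormal.starProjection_span_range {ι : Type*} [Fintype ι] {b : ι → E}
    (hb : Orthonormal ℝ b) [(Submodule.span ℝ (Set.range b)).HasOrthogonalProjection] (x : E) :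
    (Submodule.span ℝ (Set.range b)).starProjection x = ∑ i, (inner ℝ (b i) x : ℝ) • b i := by
  classical
  refine Submodule.eq_starProjection_of_mem_orthogonal
    (Submodule.sum_mem _ fun i _ => Submodule.smul_mem _ _ (Submodule.subset_span ⟨i, rfl⟩)) ?_
  rw [Submodule.mem_orthogonal]
  intro w hw
  induction hw using Submodule.span_induction with
  | mem w hw =>
    obtain ⟨j, rfl⟩ := hw
    rw [inner_sub_right, inner_sum]
    simp [real_inner_smul_right, orthonormal_iff_ite.1 hb]
  | zero => simp
  | add w z _ _ hw hz => rw [inner_add_left, hw, hz, add_zero]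
  | smul a w _ hw => rw [real_inner_smul_left, hw, mul_zero]

/-- Both projections are sums of rank-one projections; pairing them by index and using the triangle
inequality produces the factor `Fintype.card ι`, which becomes `M`. -/
theorem norm_starProjection_span_sub_le {ι : Type*} [Fintype ι] {b b' : ι → E}
    (hb : Orthonormal ℝ b) (hb' : Orthonormal ℝ b')
    {K K' : Submodule ℝ E} [K.HasOrthogonalProjection] [K'.HasOrthogonalProjection]
    (hK : K = Submodule.span ℝ (Set.range b)) (hK' : K' = Submodule.span ℝ (Set.range b'))
    {β : ℝ} (hβ : 0 ≤ β) (h : ∀ i, β ≤ inner ℝ (b i) (b' i)) :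
    ‖K.starProjection - K'.starProjection‖ ≤ Fintype.card ι * √(1 - β ^ 2) := by
  subst hK hK'
  refine ContinuousLinearMap.opNorm_le_bound _ (by positivity) fun x => ?_
  rw [sub_apply, hb.starProjection_span_range, hb'.starProjection_span_range,
    ← Finset.sum_sub_distrib]
  refine (norm_sum_le_of_le _ fun i _ =>
    norm_inner_smul_sub_inner_smul_le (hb.1 i) (hb'.1 i) hβ (h i) x).trans ?_
  rw [Finset.sum_const, Finset.card_univ, nsmul_eq_mul, mul_assoc]

open OrthTSD in
theorem OrthTSD.IsOrthogonalDecomposition.sum_norm_sq [CompleteSpace E] {m : ℕ}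
    {P' : Fin m → E →L[ℝ] E} (h : IsOrthogonalDecomposition P') (x : E) :
    ∑ k, ‖P' k x‖ ^ 2 = ‖x‖ ^ 2 := by
  have hself : ∀ k, ∀ z w, inner ℝ (P' k z) w = (inner ℝ z (P' k w) : ℝ) := fun k =>
    (h.isProj k).isSelfAdjoint.isSymmetric
  have hidem : ∀ k z, P' k (P' k z) = P' k z := fun k z =>
    DFunLike.congr_fun (h.isProj k).isIdempotentElem z
  -- The residual is orthogonal to every range, and the ranges span.
  have hzero : x - ∑ k, P' k x = 0 := by
    have hmem : x - ∑ k, P' k x ∈ (⨆ k, (P' k).range)ᗮ := by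
      rw [← Submodule.iInf_orthogonal, Submodule.mem_iInf]
      intro j
      rw [Submodule.mem_orthogonal]
      rintro _ ⟨z, rfl⟩
      have hne : ∀ k ∈ Finset.univ, k ≠ j → inner ℝ (P' j z) (P' k x) = (0 : ℝ) := fun k _ hk =>
        (h.orthogonal j k hk.symm).inner_eq ⟨z, rfl⟩ ⟨x, rfl⟩
      change inner ℝ (P' j z) _ = (0 : ℝ)
      rw [inner_sub_right, inner_sum, Finset.sum_eq_single j hne (by simp), hself j z (P' j x),
        hidem, hself, sub_self]
    rwa [h.span, Submodule.top_orthogonal_eq_bot, Submodule.mem_bot] at hmem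
  have hterm : ∀ k, ‖P' k x‖ ^ 2 = inner ℝ x (P' k x) := fun k => by
    rw [← real_inner_self_eq_norm_sq, hself, hidem]
  rw [Finset.sum_congr rfl fun k _ => hterm k, ← inner_sum, ← sub_eq_zero.1 hzero,
    real_inner_self_eq_norm_sq]

open OrthTSD in
theorem OrthTSD.IsOrthogonalDecomposition.norm_le_of_norm_sub_le [CompleteSpace E] {m : ℕ}
    {P P' : Fin m → E →L[ℝ] E} (h : IsOrthogonalDecomposition P') {γ : ℝ}
    (hγ : ∀ k, ‖P' k - P k‖ ≤ γ) (hγ1 : √m * γ < 1) (x : E) :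
    ‖x‖ ≤ 1 / (1 - √m * γ) * √(∑ k, ‖P k x‖ ^ 2) := by
  have h1 : ‖WithLp.toLp 2 fun k => P' k x‖ = ‖x‖ := by
    rw [PiLp.norm_eq_of_L2]
    change √(∑ k, ‖P' k x‖ ^ 2) = _
    rw [h.sum_norm_sq, Real.sqrt_sq (norm_nonneg _)]
  have h2 : ‖WithLp.toLp 2 fun k => P k x‖ = √(∑ k, ‖P k x‖ ^ 2) := PiLp.norm_eq_of_L2 _
  have h3 : ‖WithLp.toLp 2 fun k => (P' k - P k) x‖ ≤ √m * γ * ‖x‖ := by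
    -- For `m = 0` the bound on `γ` is vacuous and `γ` may be negative.
    rcases Nat.eq_zero_or_pos m with rfl | hm
    · rw [PiLp.norm_eq_of_L2]; simp
    have hγ0 : 0 ≤ γ := (norm_nonneg _).trans (hγ ⟨0, hm⟩)
    rw [PiLp.norm_eq_of_L2]
    refine Real.sqrt_le_iff.2 ⟨by positivity, ?_⟩
    refine (Finset.sum_le_card_nsmul _ _ ((γ * ‖x‖) ^ 2) fun k _ => ?_).trans_eq ?_
    · exact pow_le_pow_left₀ (norm_nonneg _) ((P' k - P k).le_of_opNorm_le (hγ k) x) 2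
    · rw [Finset.card_univ, Fintype.card_fin, nsmul_eq_mul, mul_assoc, mul_pow √(m : ℝ),
        Real.sq_sqrt (Nat.cast_nonneg m)]
  have h4 : (WithLp.toLp 2 fun k => P' k x) =
      (WithLp.toLp 2 fun k => P k x) + WithLp.toLp 2 fun k => (P' k - P k) x := by
    ext k; simp
  have h5 := norm_add_le (WithLp.toLp 2 fun k => P k x) (WithLp.toLp 2 fun k => (P' k - P k) x)
  rw [← h4, h1, h2] at h5
  rw [one_div, inv_mul_eq_div, le_div_iff₀ (by linarith)]
  linarith

end Projections

namespace OrthTSD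

/-! ### The skew basis -/

/-- The matrix `(e_i e_jᵀ - e_j e_iᵀ) / √2`. -/
noncomputable def skewUnit {n : ℕ} (i j : Fin n) : skew n :=
  ⟨(1 / √2) • (Matrix.single i j (1 : ℝ) - Matrix.single j i 1), by
    refine (skew n).smul_mem _ ?_
    change (_ - _)ᵀ = -(_ - _)
    rw [Matrix.transpose_sub, Matrix.transpose_single, Matrix.transpose_single, neg_sub]⟩

theorem coe_skewUnit {n : ℕ} (i j : Fin n) : (skewUnit i j : Mat n) =
    (1 / √2) • (Matrix.single i j (1 : ℝ) - Matrix.single j i 1) := rfl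

theorem mem_skewBasis {n : ℕ} {H : Mat n} :
    H ∈ skewBasis n ↔ ∃ i j : Fin n, i < j ∧ H = skewUnit i j := Iff.rfl

theorem inner_skewUnit {n : ℕ} (i j : Fin n) (A : skew n) :
    inner ℝ (skewUnit i j) A = √2 * (A : Mat n) i j := by
  have hA : (A : Mat n) j i = -(A : Mat n) i j := congrFun (congrFun A.2 i) j
  change ((skewUnit i j : Mat n)ᵀ * (A : Mat n)).trace = _
  rw [coe_skewUnit, Matrix.transpose_smul, Matrix.transpose_sub, Matrix.transpose_single,
    Matrix.transpose_single, Matrix.smul_mul, Matrix.sub_mul, Matrix.trace_smul, Matrix.trace_sub,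
    Matrix.trace_single_mul, Matrix.trace_single_mul, hA]
  simp only [smul_eq_mul, one_mul]
  have h2 : √2 * √2 = (2 : ℝ) := Real.mul_self_sqrt (by norm_num)
  field_simp
  linear_combination -(A : Mat n) i j * h2

theorem inner_skewUnit_skewUnit {n : ℕ} {i j k l : Fin n} (hij : i < j) (hkl : k < l) :
    inner ℝ (skewUnit i j) (skewUnit k l) = if i = k ∧ j = l then (1 : ℝ) else 0 := by
  rw [inner_skewUnit, coe_skewUnit]
  have h2 : √2 ≠ (0 : ℝ) := by positivity
  have h3 : ¬ (i = l ∧ j = k) := by rintro ⟨rfl, rfl⟩; exact absurd hij hkl.asymm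
  simp only [Matrix.smul_apply, Matrix.sub_apply, Matrix.single_apply, smul_eq_mul,
    eq_comm (a := k), eq_comm (a := l), h3, if_false, sub_zero]
  split_ifs
  · field_simp
  · simp

/-- The members of the skew basis, as elements of `skew n`. -/
def skewVec {n : ℕ} (H : skewBasis n) : skew n :=
  ⟨H, by obtain ⟨i, j, _, h⟩ := mem_skewBasis.1 H.2; rw [h]; exact (skewUnit i j).2⟩

theorem orthonormal_skewVec (n : ℕ) : Orthonormal ℝ (skewVec (n := n)) := by
  classical
  rw [orthonormal_iff_ite]
  rintro ⟨_, i, j, hij, rfl⟩ ⟨_, k, l, hkl, rfl⟩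
  refine (inner_skewUnit_skewUnit hij hkl).trans ?_
  by_cases h : i = k ∧ j = l
  · obtain ⟨rfl, rfl⟩ := h
    simp
  · rw [if_neg h, if_neg]
    intro he
    have he' : skewUnit i j = skewUnit k l := Subtype.ext (Subtype.mk.inj he)
    have h1 := inner_skewUnit_skewUnit hij hkl
    have h2 := inner_skewUnit_skewUnit hkl hkl
    rw [he', h2, if_neg h] at h1
    simp at h1

theorem span_range_skewVec (n : ℕ) : Submodule.span ℝ (Set.range (skewVec (n := n))) = ⊤ := by
  have hlt : ∀ i j : Fin n, i < j →
      skewUnit i j ∈ Submodule.span ℝ (Set.range (skewVec (n := n))) := fun i j hij =>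
    Submodule.subset_span ⟨⟨_, i, j, hij, rfl⟩, rfl⟩
  have hswap : ∀ i j : Fin n, skewUnit i j = -skewUnit j i := fun i j => by
    apply Subtype.ext
    rw [Submodule.coe_neg, coe_skewUnit, coe_skewUnit, ← smul_neg, neg_sub]
  have hmem : ∀ i j : Fin n,
      skewUnit i j ∈ Submodule.span ℝ (Set.range (skewVec (n := n))) := fun i j => by
    rcases lt_trichotomy i j with h | rfl | h
    · exact hlt i j h
    · rw [show skewUnit i i = 0 from Subtype.ext (by simp [coe_skewUnit])]
      exact zero_mem _
    · rw [hswap]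
      exact neg_mem (hlt j i h)
  rw [eq_top_iff]
  intro A _
  -- Summing over all ordered pairs yields `(A - Aᵀ)/2`, which is `A`.
  have hA : A = ∑ i, ∑ j, ((A : Mat n) i j / √2) • skewUnit i j := by
    apply Subtype.ext
    have h2 : √2 * √2 = (2 : ℝ) := Real.mul_self_sqrt (by norm_num)
    have h1 : (A : Mat n) = ∑ i, ∑ j, Matrix.single i j ((A : Mat n) i j) :=
      Matrix.matrix_eq_sum_single _
    have h3 : (A : Mat n)ᵀ = ∑ i, ∑ j, Matrix.single j i ((A : Mat n) i j) := by
      conv_lhs => rw [h1]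
      simp only [Matrix.transpose_sum, Matrix.transpose_single]
    have hAT : (A : Mat n)ᵀ = -(A : Mat n) := A.2
    simp only [Submodule.coe_sum, Submodule.coe_smul, coe_skewUnit, smul_sub,
      Matrix.smul_single, smul_eq_mul, mul_one, Finset.sum_sub_distrib]
    have h4 : ∀ a : ℝ, a / √2 * (1 / √2) = (1 / 2 : ℝ) * a := fun a => by
      rw [div_mul_div_comm, h2]; ring
    simp only [h4, ← smul_eq_mul (1 / 2 : ℝ), ← Matrix.smul_single, ← Finset.smul_sum]
    rw [← h1, ← h3, hAT]
    module
  rw [hA]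
  exact Submodule.sum_mem _ fun i _ => Submodule.sum_mem _ fun j _ =>
    Submodule.smul_mem _ _ (hmem i j)

/-! ### Rotating a member of the skew basis -/

theorem coe_mul_coe_skewUnit {n : ℕ} {i j : Fin n} (hij : i < j) :
    (skewUnit i j : Mat n) * (skewUnit i j : Mat n)ᵀ =
      (1 / 2 : ℝ) • (Matrix.single i i 1 + Matrix.single j j 1) := by
  have h2 : √2 * √2 = (2 : ℝ) := Real.mul_self_sqrt (by norm_num)
  rw [coe_skewUnit, Matrix.transpose_smul, Matrix.transpose_sub, Matrix.transpose_single,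
    Matrix.transpose_single, Matrix.smul_mul, Matrix.mul_smul, smul_smul, div_mul_div_comm, h2,
    one_mul, Matrix.sub_mul, Matrix.mul_sub, Matrix.mul_sub, Matrix.single_mul_single_same,
    Matrix.single_mul_single_same, Matrix.single_mul_single_of_ne _ _ _ _ hij.ne',
    Matrix.single_mul_single_of_ne _ _ _ _ hij.ne]
  simp

/-- As `h hᵀ` is half the coordinate projection onto `e_i, e_j`, only half the squared norm of two
columns of `E` survives. This factor `1/2`, absent from submultiplicativity, gives `1 - ‖R - 1‖²`
below without a factor `2`. -/
theorem norm_mul_skewUnit_sq_le {n : ℕ} (E : Mat n) {i j : Fin n} (hij : i < j) :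
    ‖E * (skewUnit i j : Mat n)‖ ^ 2 ≤ ‖E‖ ^ 2 / 2 := by
  rw [norm_sq_eq_trace, norm_sq_eq_trace, Matrix.transpose_mul, Matrix.mul_assoc,
    Matrix.trace_mul_comm, Matrix.mul_assoc, Matrix.mul_assoc, coe_mul_coe_skewUnit hij,
    ← Matrix.mul_assoc, Matrix.mul_smul, Matrix.trace_smul, Matrix.mul_add, Matrix.trace_add,
    Matrix.trace_mul_comm, Matrix.trace_single_mul, Matrix.trace_mul_comm (Eᵀ * E),
    Matrix.trace_single_mul]
  have hnn : ∀ k ∈ Finset.univ, 0 ≤ (Eᵀ * E).diag k := fun k _ => by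
    rw [Matrix.diag_apply, Matrix.mul_apply]
    exact Finset.sum_nonneg fun l _ => mul_self_nonneg _
  have hsum : ∑ k ∈ {i, j}, (Eᵀ * E).diag k ≤ (Eᵀ * E).trace :=
    Finset.sum_le_sum_of_subset_of_nonneg (Finset.subset_univ _) fun k hk _ => hnn k (by simp)
  rw [Finset.sum_pair hij.ne] at hsum
  simp only [Matrix.diag_apply, smul_eq_mul, one_mul] at hsum ⊢
  linarith

theorem norm_transpose {n : ℕ} (E : Mat n) : ‖Eᵀ‖ = ‖E‖ := by
  rw [← sq_eq_sq₀ (norm_nonneg _) (norm_nonneg _), norm_sq_eq_trace, norm_sq_eq_trace,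
    Matrix.transpose_transpose, Matrix.trace_mul_comm]

theorem norm_skewUnit_mul_sq_le {n : ℕ} (E : Mat n) {i j : Fin n} (hij : i < j) :
    ‖(skewUnit i j : Mat n) * E‖ ^ 2 ≤ ‖E‖ ^ 2 / 2 := by
  have hT : (skewUnit i j : Mat n)ᵀ = -(skewUnit i j : Mat n) := (skewUnit i j).2
  have h := norm_mul_skewUnit_sq_le Eᵀ hij
  rwa [← norm_transpose, Matrix.transpose_mul, Matrix.transpose_transpose, hT, Matrix.neg_mul,
    norm_neg, norm_transpose] at h

/-- Conjugation by a rotation `R` turns a member of the skew basis by an angle with cosine at least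
`1 - ‖R - 1‖²`. -/
theorem le_inner_conj_skewVec {n : ℕ} (R : O n) (H : skewBasis n) :
    1 - ‖(R : Mat n) - 1‖ ^ 2 ≤ inner ℝ (conj R (skewVec H)) (skewVec H) := by
  obtain ⟨_, i, j, hij, rfl⟩ := H
  set h : skew n := skewUnit i j with hh
  change 1 - ‖(R : Mat n) - 1‖ ^ 2 ≤ inner ℝ (conj R h) h
  have hnorm : ‖h‖ = 1 := (orthonormal_skewVec n).1 ⟨_, i, j, hij, rfl⟩
  have hconj : ‖conj R h‖ = 1 := by
    rw [← hnorm, ← sq_eq_sq₀ (norm_nonneg _) (norm_nonneg _)]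
    change ‖(conj R h : Mat n)‖ ^ 2 = ‖(h : Mat n)‖ ^ 2
    rw [norm_sq_eq_trace, norm_sq_eq_trace, trace_conj]
  -- Multiplying by `R` on the left turns the difference into `hR - Rh`, the commutator of `h` with
  -- `R - 1`.
  have hdiff : ‖conj R h - h‖ = ‖(h : Mat n) * ((R : Mat n) - 1) - ((R : Mat n) - 1) * h‖ := by
    change ‖(R : Mat n)ᵀ * (h : Mat n) * (R : Mat n) - h‖ = _
    rw [← norm_orthogonal_mul R]
    congr 1
    rw [mul_sub, ← mul_assoc, ← mul_assoc, mul_transpose_self]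
    noncomm_ring
  have ha := norm_skewUnit_mul_sq_le ((R : Mat n) - 1) hij
  have hb := norm_mul_skewUnit_sq_le ((R : Mat n) - 1) hij
  have hle : ‖conj R h - h‖ ^ 2 ≤ 2 * ‖(R : Mat n) - 1‖ ^ 2 := by
    rw [hdiff]
    refine (pow_le_pow_left₀ (norm_nonneg _) (norm_sub_le _ _) 2).trans ?_
    nlinarith [sq_nonneg (‖(h : Mat n) * ((R : Mat n) - 1)‖ - ‖((R : Mat n) - 1) * (h : Mat n)‖)]
  rw [norm_sub_sq_real, hnorm, hconj] at hle
  linarith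

/-! ### The transported projections of the block rule -/

/-- `A ↦ Y A`, as an isometry of the skew-symmetric matrices onto `T_Y O_n`. -/
noncomputable def ofSkewIso {n : ℕ} (Y : O n) : skew n ≃ₗᵢ[ℝ] T Y where
  toFun := ofSkew Y
  invFun := skewPart
  map_add' A B := toMat_injective (by simp [toMat_ofSkew, Matrix.mul_add])
  map_smul' c A := toMat_injective (by simp [toMat_ofSkew])
  left_inv := skewPart_ofSkew Y
  right_inv := ofSkew_skewPart
  norm_map' := norm_ofSkew Y

theorem ofSkewIso_trans_parallelTransport_apply {n : ℕ} (X Y : O n) (V : T X) (A : skew n) :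
    ((ofSkewIso X).trans (parallelTransport X Y V)) A = ofSkewIso Y (conj (halfExp V) A) := by
  change ofSkew Y (conj (halfExp V) (skewPart (ofSkew X A))) = ofSkew Y (conj (halfExp V) A)
  rw [skewPart_ofSkew]

theorem blockSubspace_eq_map {n : ℕ} (Y : O n) (S : Finset (Mat n)) :
    blockSubspace Y S = ((Submodule.span ℝ (S : Set (Mat n))).comap (skew n).subtype).map
      ((ofSkewIso Y).toLinearEquiv : skew n →ₗ[ℝ] T Y) := by
  ext V
  constructor
  · rintro ⟨A, hA, hAV⟩
    refine ⟨skewPart V, ?_, ofSkew_skewPart V⟩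
    have : ((skewPart V : skew n) : Mat n) = A := by
      change (Y : Mat n)ᵀ * toMat V = A
      rw [← hAV]
      change (Y : Mat n)ᵀ * ((Y : Mat n) * A) = A
      rw [← Matrix.mul_assoc, transpose_mul_self, one_mul]
    change ((skewPart V : skew n) : Mat n) ∈ Submodule.span ℝ (S : Set (Mat n))
    rwa [this]
  · rintro ⟨A, hA, rfl⟩
    exact ⟨A, hA, rfl⟩

theorem comap_span_eq_span_skewVec {n : ℕ} {S : Set (Mat n)} (hS : S ⊆ skewBasis n) :
    (Submodule.span ℝ S).comap (skew n).subtype =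
      Submodule.span ℝ (Set.range fun H : S => skewVec ⟨H, hS H.2⟩) := by
  have h : S = (skew n).subtype '' Set.range fun H : S => skewVec ⟨H, hS H.2⟩ := by
    rw [← Set.range_comp]
    exact Subtype.range_coe.symm
  conv_lhs => rw [h]
  rw [Submodule.span_image, Submodule.comap_map_eq_of_injective (skew n).injective_subtype]

/-- Conjugating an orthogonal projection by an isometry gives the projection onto the image
subspace; here the isometry from `skew n` is `A ↦ Y⁰ Rᵀ A R`. -/
theorem transportedProj_blockRule {n m : ℕ} (B : Fin m → Finset (Mat n)) (y : ℕ → O n)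
    (V : (k : Fin m) → T (y k)) (k : Fin m) :
    transportedProj (blockRule B) y V k =
      (((Submodule.span ℝ (B k : Set (Mat n))).comap (skew n).subtype).map
        (((ofSkewIso (y k)).trans (parallelTransport (y k) (y 0) (V k))).toLinearEquiv :
          skew n →ₗ[ℝ] T (y 0))).starProjection := by
  ext1 W
  rw [Submodule.starProjection_map_apply]
  change parallelTransport (y k) (y 0) (V k) ((blockSubspace (y k) (B k)).starProjection
    ((parallelTransport (y k) (y 0) (V k)).symm W)) = _
  simp only [blockSubspace_eq_map]
  rw [Submodule.starProjection_map_apply]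
  rfl

/-! ### From small Riemannian distance to a small gap -/

theorem riemDist_self {n : ℕ} (X : O n) : riemDist X X = 0 := by
  rw [← nonpos_iff_eq_zero]
  refine iInf₂_le_of_le (fun _ => (X : Mat n)) ?_ ?_
  · exact ⟨rfl, rfl, fun _ _ => X.2, continuousOn_const, 1, ![0, 1],
      by simp [Fin.strictMono_iff_lt_succ], rfl, rfl, fun _ => contDiffOn_const⟩
  · have h : ∀ s : ℝ, ‖deriv (fun _ : ℝ => (X : Mat n)) s‖ₑ = 0 := fun s =>
      (congrArg enorm (deriv_const s (X : Mat n))).trans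
        (by rw [← ofReal_norm, norm_zero, ENNReal.ofReal_zero])
    exact ((MeasureTheory.lintegral_congr h).trans MeasureTheory.lintegral_zero).le

/-- The transport `R = expm (C / 2)` along a shortest geodesic is close to the identity if the
Riemannian distance is small. -/
theorem norm_halfExp_sub_one_sq_le {n : ℕ} {X Y : O n} {V : T X} (hV : V ∈ invExp X Y) {β : ℝ}
    (hβ : β ∈ Set.Ioo (0 : ℝ) 1)
    (hd : riemDist Y X ≤ ENNReal.ofReal (2 * Real.log (1 + √(1 - β)))) :
    ‖(halfExp V : Mat n) - 1‖ ^ 2 ≤ 1 - β := by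
  obtain ⟨hVY, hmin⟩ := hV
  set C : skew n := skewPart V with hC
  set u := Real.log (1 + √(1 - β)) with hu
  have hx0 : 0 ≤ √(1 - β) := Real.sqrt_nonneg _
  have hx1 : √(1 - β) ≤ 1 := Real.sqrt_le_one.2 (by linarith [hβ.1])
  have hu0 : 0 ≤ u := Real.log_nonneg (by linarith)
  -- `u ≤ log 2 < 0.7`, whence the constant `7 / 10`.
  have hu1 : u ≤ 7 / 10 := by
    have h1 : u ≤ Real.log 2 := Real.log_le_log (by linarith) (by linarith)
    linarith [Real.log_two_lt_d9]
  have hexpC : (X : Mat n) * NormedSpace.exp (C : Mat n) = Y := congrArg Subtype.val hVY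
  have hchord : ‖NormedSpace.exp (C : Mat n) - 1‖ ≤ 2 * u := by
    -- The chord is symmetric in its endpoints, so symmetry of `riemDist` is not needed.
    rw [← norm_orthogonal_mul X, Matrix.mul_sub, hexpC, mul_one, norm_sub_rev]
    exact norm_sub_le_of_riemDist_le (by linarith) hd
  have hmin' : ∀ D ∈ skew n, NormedSpace.exp D = NormedSpace.exp (C : Mat n) →
      ‖(C : Mat n)‖ ≤ ‖D‖ := by
    intro D hD hDC
    have h := hmin (ofSkew X ⟨D, hD⟩) (by
      apply Subtype.ext
      change (X : Mat n) * NormedSpace.exp ((skewPart (ofSkew X ⟨D, hD⟩) : skew n) : Mat n) = Y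
      rw [skewPart_ofSkew, hDC, hexpC])
    rwa [← ofSkew_skewPart V, norm_ofSkew, norm_ofSkew] at h
  have h := norm_exp_half_sub_one_le C.2 hmin' hu0 hu1 hchord
  have hexp : u + u ^ 2 / 2 ≤ √(1 - β) := by
    have h1 := Real.quadratic_le_exp_of_nonneg hu0
    rw [hu, Real.exp_log (by linarith), ← hu] at h1
    linarith
  have h2 := pow_le_pow_left₀ (norm_nonneg _) (h.trans hexp) 2
  rwa [Real.sq_sqrt (by linarith [hβ.2])] at h2

/-- The common part of both halves of the gap theorem: the projections onto `{Y⁰ A : A ∈ span Bₖ}`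
form an orthogonal decomposition close to the transported projections. -/
theorem exists_decomposition_blockRule {n m : ℕ} {B : Fin m → Finset (Mat n)}
    (hB : IsSkewPartition B) {β : ℝ} (hβ : β ∈ Set.Ioo (0 : ℝ) 1) (y : ℕ → O n)
    (hd : ∀ k : Fin m,
      riemDist (y 0) (y (k + 1)) ≤ ENNReal.ofReal (2 * Real.log (1 + √(1 - β))))
    (V : (k : Fin m) → T (y k)) (hV : ∀ k : Fin m, V k ∈ invExp (y k) (y 0)) :
    ∃ P' : Fin m → T (y 0) →L[ℝ] T (y 0), IsOrthogonalDecomposition P' ∧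
      ∀ k, Module.finrank ℝ (transportedProj (blockRule B) y V k).range =
          Module.finrank ℝ (P' k).range ∧
        ‖P' k - transportedProj (blockRule B) y V k‖ ≤ maxCard B * √(1 - β ^ 2) := by
  have hsub : ∀ k, (B k : Set (Mat n)) ⊆ skewBasis n := fun k =>
    hB.union ▸ Set.subset_iUnion (fun k => (B k : Set (Mat n))) k
  set K : Fin m → Submodule ℝ (skew n) := fun k =>
    (Submodule.span ℝ (B k : Set (Mat n))).comap (skew n).subtype with hK
  have hKspan : ∀ k, K k =
      Submodule.span ℝ (Set.range fun H : (B k : Set (Mat n)) => skewVec ⟨H, hsub k H.2⟩) :=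
    fun k => comap_span_eq_span_skewVec (hsub k)
  -- The hypothesis concerns `Y¹, …, Yᵐ`, whereas the transports start at `Y⁰, …, Yᵐ⁻¹`; the missing
  -- index `0` has distance zero.
  have hd' : ∀ k : Fin m, riemDist (y 0) (y k) ≤
      ENNReal.ofReal (2 * Real.log (1 + √(1 - β))) := by
    rintro ⟨k, hk⟩
    rcases k with _ | k
    · refine le_trans ?_ (zero_le (a := ENNReal.ofReal _))
      exact (riemDist_self (y 0)).le
    · exact hd ⟨k, by omega⟩
  refine ⟨fun k => ((K k).map ((ofSkewIso (y 0)).toLinearEquiv :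
    skew n →ₗ[ℝ] T (y 0))).starProjection, ⟨fun k => isStarProjection_starProjection, ?_, ?_⟩,
    fun k => ⟨?_, ?_⟩⟩
  · intro i j hij
    simp only [Submodule.range_starProjection]
    refine Submodule.IsOrtho.map (ofSkewIso (y 0)).toLinearIsometry ?_
    rw [hKspan, hKspan, Submodule.isOrtho_span]
    rintro _ ⟨H, rfl⟩ _ ⟨H', rfl⟩
    refine (orthonormal_skewVec n).2 fun h => ?_
    have h' : (H : Mat n) = H' := congrArg Subtype.val h
    exact Finset.disjoint_left.1 (hB.disjoint i j hij) H.2 (h' ▸ H'.2)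
  · simp only [Submodule.range_starProjection]
    rw [← Submodule.map_iSup]
    have htop : ⨆ k, K k = ⊤ := by
      rw [eq_top_iff, ← span_range_skewVec n, Submodule.span_le]
      rintro _ ⟨H, rfl⟩
      have hH : (H : Mat n) ∈ ⋃ k, (B k : Set (Mat n)) := by rw [hB.union]; exact H.2
      obtain ⟨k, hk⟩ := Set.mem_iUnion.1 hH
      exact Submodule.mem_iSup_of_mem k (Submodule.subset_span hk)
    rw [htop, Submodule.map_top, LinearMap.range_eq_top]
    exact (ofSkewIso (y 0)).surjective
  · rw [transportedProj_blockRule, Submodule.range_starProjection, Submodule.range_starProjection,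
      LinearEquiv.finrank_map_eq, LinearEquiv.finrank_map_eq]
  · have hon : Orthonormal ℝ fun H : (B k : Set (Mat n)) => skewVec ⟨H, hsub k H.2⟩ :=
      (orthonormal_skewVec n).comp (fun H : (B k : Set (Mat n)) => ⟨H, hsub k H.2⟩)
        fun H H' h => Subtype.ext (Subtype.mk.inj h)
    set f := (ofSkewIso (y k)).trans (parallelTransport (y k) (y 0) (V k)) with hf
    have hmap : ∀ g : skew n ≃ₗᵢ[ℝ] T (y 0),
        (K k).map (g.toLinearEquiv : skew n →ₗ[ℝ] T (y 0)) = Submodule.span ℝ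
          (Set.range fun H : (B k : Set (Mat n)) => g (skewVec ⟨H, hsub k H.2⟩)) := fun g => by
      rw [hKspan, Submodule.map_span, ← Set.range_comp]
      rfl
    have hcos : ∀ H : (B k : Set (Mat n)), β ≤ inner ℝ
        (ofSkewIso (y 0) (skewVec ⟨H, hsub k H.2⟩)) (f (skewVec ⟨H, hsub k H.2⟩)) := by
      intro H
      rw [hf, ofSkewIso_trans_parallelTransport_apply, LinearIsometryEquiv.inner_map_map,
        real_inner_comm]
      have h1 := le_inner_conj_skewVec (halfExp (V k)) ⟨H, hsub k H.2⟩
      have h2 := norm_halfExp_sub_one_sq_le (hV k) hβ (hd' k)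
      linarith
    have hgap := norm_starProjection_span_sub_le
      (hon.comp_linearIsometry (ofSkewIso (y 0)).toLinearIsometry)
      (hon.comp_linearIsometry f.toLinearIsometry) (hmap _) (hmap f) hβ.1.le hcos
    have hcard : Fintype.card (B k : Set (Mat n)) ≤ maxCard B := by
      rw [← Set.toFinset_card, Finset.toFinset_coe]
      exact Finset.le_sup (f := fun k => (B k).card) (Finset.mem_univ k)
    rw [transportedProj_blockRule]
    exact hgap.trans (mul_le_mul_of_nonneg_right (Nat.cast_le.2 hcard) (Real.sqrt_nonneg _))

end OrthTSD

/-! ### The gap property and the norm inequality -/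

open OrthTSD in
theorem theorem6p1 {n m : ℕ} (B : Fin m → Finset (Mat n)) (hB : IsSkewPartition B)
    (β : ℝ) (hβ : β ∈ Set.Ioo (0 : ℝ) 1) :
    IsGapEnsuring (blockRule B) (maxCard B * √(1 - β ^ 2)) (2 * Real.log (1 + √(1 - β))) ∧
    (√(1 - 1 / (m * (maxCard B : ℝ) ^ 2)) < β →
      ∀ f : Mat n → ℝ, DifferentiableOn ℝ f (OSet n) →
      ∀ (x : ℕ → O n) (y : ℕ → ℕ → O n) (η : ℕ → Fin m → ℝ), IsTSDRun f (blockRule B) x y η →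
      ∀ t, 1 ≤ t →
        (∀ k : Fin m, riemDist (y t 0) (y t (k + 1)) ≤
          ENNReal.ofReal (2 * Real.log (1 + √(1 - β)))) →
        ∀ V : (k : Fin m) → T (y t k), (∀ k : Fin m, V k ∈ invExp (y t k) (y t 0)) →
          ∀ W : T (y t 0),
            ‖W‖ ≤ 1 / (1 - √(m * (1 - β ^ 2)) * maxCard B) * ruleNorm (blockRule B) (y t) V W) := by
  constructor
  · intro f _ x y η _ t _ hd V hV
    exact exists_decomposition_blockRule hB hβ (y t) hd V hV
  · intro hlarge f _ x y η _ t _ hd V hV W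
    obtain ⟨P', hP', hgap⟩ := exists_decomposition_blockRule hB hβ (y t) hd V hV
    set a : ℝ := m * (maxCard B : ℝ) ^ 2 with ha
    -- If `m M² = 0`, then `1 / 0 = 0` makes the threshold `1`, contradicting `β < 1`.
    have ha0 : 0 < a := by
      refine lt_of_le_of_ne (by positivity) fun h => ?_
      rw [← h, div_zero, sub_zero, Real.sqrt_one] at hlarge
      exact hlarge.not_gt hβ.2
    have hβa : 1 - 1 / a < β ^ 2 := (Real.sqrt_lt' hβ.1).1 hlarge
    have hlt : a * (1 - β ^ 2) < 1 := by
      have := mul_lt_mul_of_pos_left hβa ha0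
      rw [mul_sub, mul_one_div_cancel ha0.ne'] at this
      linarith
    have hγ : √(m * (1 - β ^ 2)) * maxCard B = √m * (maxCard B * √(1 - β ^ 2)) := by
      rw [Real.sqrt_mul (Nat.cast_nonneg m)]; ring
    have hsmall : √m * (maxCard B * √(1 - β ^ 2)) < 1 := by
      rw [← hγ, ← Real.sqrt_sq (Nat.cast_nonneg (α := ℝ) (maxCard B)), ← Real.sqrt_mul' _
        (sq_nonneg _), Real.sqrt_lt' one_pos]
      linarith
    rw [hγ]
    exact hP'.norm_le_of_norm_sub_le (fun k => (hgap k).2) hsmall W
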